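/- Let $d\ge 1$, let $u\in\mathbb C\setminus\{0\}$, and for $n\ge 0$ let $\mathrm Y_{d,n}(u)$ be the Yokonuma--Hecke algebra: the unital associative $\mathbb C$-algebra with generators $g_1,\dots,g_{n-1},t_1,\dots,t_n$ and relations $g_ig_j=g_jg_i$ for $|i-j|>1$; $g_{i+1}g_ig_{i+1}=g_ig_{i+1}g_i$; $t_it_j=t_jt_i$; $t_i^d=1$; $g_it_i=t_{i+1}g_i$; $g_it_{i+1}=t_ig_i$; $g_it_j=t_jg_i$ for $j\ne i,i+1$; $g_i^2=1+(u-1)e_i+(u-1)e_ig_i$, where $e_i=\frac1d\sum_{s=0}^{d-1}t_i^st_{i+1}^{d-s}$. For $m\in\mathbb Z/d\mathbb Z$ put $e_i^{(m)}=\frac1d\sum_{s=0}^{d-1}t_i^{m+s}t_{i+1}^{d-s}$. Let $z,x_1,\dots,x_{d-1}\in\mathbb C$, put $x_0=1$ and read the indices of the $x_k$ modulo $d$. Let $\mathrm{tr}$ be Juyumaya's Markov trace with these parameters, that is, the linear function on $\bigcup_n\mathrm Y_{d,n}(u)$ determined by $\mathrm{tr}(ab)=\mathrm{tr}(ba)$,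 $\mathrm{tr}(1)=1$, $\mathrm{tr}(ag_n)=z\,\mathrm{tr}(a)$ and $\mathrm{tr}(at_{n+1}^s)=x_s\,\mathrm{tr}(a)$ for $a,b\in\mathrm Y_{d,n}(u)$. Put $E^{(m)}=\frac1d\sum_{s\in\mathbb Z/d\mathbb Z}x_{m+s}x_{-s}$ (which is $\mathrm{tr}(e_i^{(m)})$). Let $g_{i,i+1}=1+g_i+g_{i+1}+g_ig_{i+1}+g_{i+1}g_i+g_ig_{i+1}g_i$. For $n\ge 3$ let $\mathrm{FTL}_{d,n}(u)$ be the quotient of $\mathrm Y_{d,n}(u)$ by the two-sided ideal generated by the elements $r_{i,i+1}=\sum_{a,b\in\mathbb Z/d\mathbb Z}t_i^at_{i+1}^{b-a}t_{i+2}^{-b}\,g_{i,i+1}$, and let $\mathrm{CTL}_{d,n}(u)$ be its quotient by the two-sided ideal generated by the elements $c_{i,i+1}=\sum_{a,b,c\in\mathbb Z/d\mathbb Z}t_i^at_{i+1}^bt_{i+2}^c\,g_{i,i+1}$ ($1\le i\le n-2$). One says that $\mathrm{tr}$ passes to such a quotient if its restriction to $\mathrm Y_{d,n}(u)$ factors through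 the canonical projection. Then, for every $n\ge 3$: 1. $\mathrm{tr}$ passes to $\mathrm{FTL}_{d,n}(u)$ if and only if $$(u+1)z^2x_k+(u+2)z\,E^{(k)}+\mathrm{tr}\big(e_1^{(k)}e_2\big)=0\qquad\text{for all }k\in\mathbb Z/d\mathbb Z .$$ 2. This is a restatement of the following criterion: $\mathrm{tr}$ passes to $\mathrm{FTL}_{d,n}(u)$ if and only if the support of the Fourier transform $\widehat x(m)=\sum_{k}x_k e^{-2\pi i km/d}$ is a disjoint union $S_1\sqcup S_2$ such that $|S_1|+(u+1)|S_2|\ne 0$, $$x_k=-z\Big(\sum_{m\in S_1}e^{2\pi i km/d}+(u+1)\sum_{m\in S_2}e^{2\pi i km/d}\Big)\ \ (k\in\mathbb Z/d\mathbb Z),\qquad z=-\frac1{|S_1|+(u+1)|S_2|}.$$ 3. Consequently the trace conditions for $\mathrm{FTL}_{d,n}(u)$ are contained in those for $\mathrm{CTL}_{d,n}(u)$: if $\mathrm{tr}$ passes to $\mathrm{FTL}_{d,n}(u)$, then $\mathrm{tr}$ passes to $\mathrm{CTL}_{d,n}(u)$, and $$(u+1)z^2\sum_{k}x_k+(u+2)z\sum_{k}E^{(k)}+\sum_{k}\mathrm{tr}\big(e_1^{(k)}e_2\big)=0,$$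 the sums being over $k\in\mathbb Z/d\mathbb Z$. -/

import Mathlib

noncomputable section

namespace YokonumaHecke

/-- Generators of the Yokonuma--Hecke algebra on `n` strands, indexed from `0`: `g i` is the
braiding generator exchanging the strands `i` and `i + 1`, and `t j` is the framing generator of
the strand `j`. (With indices starting from `1`, these are `g_{i+1}` and `t_{j+1}`.) -/
inductive Gen (n : ℕ) : Type
  | g (i : ℕ) (hi : i + 1 < n) : Gen n
  | t (j : ℕ) (hj : j < n) : Gen n

/-- The free generator `g_i`. -/
def fg {n : ℕ} (i : ℕ) (hi : i + 1 < n) : FreeAlgebra ℂ (Gen n) :=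
  FreeAlgebra.ι ℂ (Gen.g i hi)

/-- The free generator `t_j`. -/
def ft {n : ℕ} (j : ℕ) (hj : j < n) : FreeAlgebra ℂ (Gen n) :=
  FreeAlgebra.ι ℂ (Gen.t j hj)

/-- The word `e_i = d⁻¹ ∑_{s=0}^{d-1} t_i^s t_{i+1}^{d-s}` in the free algebra. -/
def fe (d : ℕ) {n : ℕ} (i : ℕ) (hi : i + 1 < n) : FreeAlgebra ℂ (Gen n) :=
  (1 / (d : ℂ)) •
    ∑ s ∈ Finset.range d, ft i (Nat.lt_of_succ_lt hi) ^ s * ft (i + 1) hi ^ (d - s)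

/-- The defining relations of the Yokonuma--Hecke algebra `Y_{d,n}(u)`. -/
inductive Rel (d n : ℕ) (u : ℂ) : FreeAlgebra ℂ (Gen n) → FreeAlgebra ℂ (Gen n) → Prop
  | g_comm (i j : ℕ) (hi : i + 1 < n) (hj : j + 1 < n) (hij : i + 1 < j ∨ j + 1 < i) :
      Rel d n u (fg i hi * fg j hj) (fg j hj * fg i hi)
  | braid (i : ℕ) (hi : i + 2 < n) :
      Rel d n u
        (fg (i + 1) hi * fg i (Nat.lt_of_succ_lt hi) * fg (i + 1) hi)
        (fg i (Nat.lt_of_succ_lt hi) * fg (i + 1) hi * fg i (Nat.lt_of_succ_lt hi))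
  | t_comm (i j : ℕ) (hi : i < n) (hj : j < n) :
      Rel d n u (ft i hi * ft j hj) (ft j hj * ft i hi)
  | t_pow (i : ℕ) (hi : i < n) : Rel d n u (ft i hi ^ d) 1
  | g_t (i : ℕ) (hi : i + 1 < n) :
      Rel d n u (fg i hi * ft i (Nat.lt_of_succ_lt hi)) (ft (i + 1) hi * fg i hi)
  | g_t_succ (i : ℕ) (hi : i + 1 < n) :
      Rel d n u (fg i hi * ft (i + 1) hi) (ft i (Nat.lt_of_succ_lt hi) * fg i hi)
  | g_t_of_ne (i j : ℕ) (hi : i + 1 < n) (hj : j < n) (h₁ : j ≠ i) (h₂ : j ≠ i + 1) :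
      Rel d n u (fg i hi * ft j hj) (ft j hj * fg i hi)
  | quadratic (i : ℕ) (hi : i + 1 < n) :
      Rel d n u (fg i hi ^ 2) (1 + (u - 1) • fe d i hi + (u - 1) • (fe d i hi * fg i hi))

/-- The Yokonuma--Hecke algebra `Y_{d,n}(u)`, by generators and relations. -/
abbrev Y (d n : ℕ) (u : ℂ) : Type := RingQuot (Rel d n u)

/-- The generator `g_i` of `Y_{d,n}(u)`. -/
def g (d : ℕ) {n : ℕ} (u : ℂ) (i : ℕ) (hi : i + 1 < n) : Y d n u :=
  RingQuot.mkAlgHom ℂ (Rel d n u) (fg i hi)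

/-- The generator `t_j` of `Y_{d,n}(u)`. -/
def t (d : ℕ) {n : ℕ} (u : ℂ) (j : ℕ) (hj : j < n) : Y d n u :=
  RingQuot.mkAlgHom ℂ (Rel d n u) (ft j hj)

/-- The power `t_j^a` for an exponent modulo `d` (well defined as `t_j^d = 1`). -/
def tpow {d n : ℕ} (u : ℂ) (j : ℕ) (hj : j < n) (a : ZMod d) : Y d n u := t d u j hj ^ a.val

/-- The generators of `n` strands, seen among the generators of `n + 1` strands. -/
def Gen.succ {n : ℕ} : Gen n → Gen (n + 1)
  | .g i hi => .g i (Nat.lt_succ_of_lt hi)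
  | .t j hj => .t j (Nat.lt_succ_of_lt hj)

/-- The map of free algebras sending each generator to the generator of the same name. -/
def freeIncl (n : ℕ) : FreeAlgebra ℂ (Gen n) →ₐ[ℂ] FreeAlgebra ℂ (Gen (n + 1)) :=
  FreeAlgebra.lift ℂ fun a => FreeAlgebra.ι ℂ a.succ

theorem freeIncl_fg {n : ℕ} (i : ℕ) (hi : i + 1 < n) :
    freeIncl n (fg i hi) = fg i (Nat.lt_succ_of_lt hi) := by
  simp [freeIncl, fg, Gen.succ]

theorem freeIncl_ft {n : ℕ} (j : ℕ) (hj : j < n) :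
    freeIncl n (ft j hj) = ft j (Nat.lt_succ_of_lt hj) := by
  simp [freeIncl, ft, Gen.succ]

theorem freeIncl_fe (d : ℕ) {n : ℕ} (i : ℕ) (hi : i + 1 < n) :
    freeIncl n (fe d i hi) = fe d i (Nat.lt_succ_of_lt hi) := by
  simp [fe, freeIncl_ft]

theorem freeIncl_rel {d n : ℕ} {u : ℂ} {a b : FreeAlgebra ℂ (Gen n)} (h : Rel d n u a b) :
    Rel d (n + 1) u (freeIncl n a) (freeIncl n b) := by
  induction h <;>
    simp only [map_mul, map_add, map_pow, map_one, map_smul, freeIncl_fg, freeIncl_ft, freeIncl_fe]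
  case g_comm i j hi hj hij => exact .g_comm i j _ _ hij
  case braid i hi => exact .braid i (Nat.lt_succ_of_lt hi)
  case t_comm i j hi hj => exact .t_comm i j _ _
  case t_pow i hi => exact .t_pow i _
  case g_t i hi => exact .g_t i (Nat.lt_succ_of_lt hi)
  case g_t_succ i hi => exact .g_t_succ i (Nat.lt_succ_of_lt hi)
  case g_t_of_ne i j hi hj h₁ h₂ => exact .g_t_of_ne i j _ _ h₁ h₂
  case quadratic i hi => exact .quadratic i (Nat.lt_succ_of_lt hi)

/-- The natural map `Y_{d,n}(u) → Y_{d,n+1}(u)` through which the union of the tower is formed. -/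
def incl (d n : ℕ) (u : ℂ) : Y d n u →ₐ[ℂ] Y d (n + 1) u :=
  RingQuot.liftAlgHom ℂ
    ⟨(RingQuot.mkAlgHom ℂ (Rel d (n + 1) u)).comp (freeIncl n),
      fun _ _ h => RingQuot.mkAlgHom_rel ℂ (freeIncl_rel h)⟩

/-- `tr` is the Markov trace with parameters `z` and `x_1, …, x_{d-1}` on the tower of
Yokonuma--Hecke algebras, given by its inductive rules (used with `x 0 = 1`). The rule `incl` says
that `tr` is one function on the union of the tower. -/
structure IsMarkovTrace (d : ℕ) (u z : ℂ) (x : ZMod d → ℂ)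
    (tr : ∀ n : ℕ, Y d n u →ₗ[ℂ] ℂ) : Prop where
  incl : ∀ (n : ℕ) (a : Y d n u), tr (n + 1) (incl d n u a) = tr n a
  comm : ∀ (n : ℕ) (a b : Y d n u), tr n (a * b) = tr n (b * a)
  one : ∀ n : ℕ, tr n 1 = 1
  markov : ∀ (n : ℕ) (a : Y d (n + 1) u),
    tr (n + 2) (YokonumaHecke.incl d (n + 1) u a * g d u n (Nat.lt_succ_self (n + 1)))
      = z * tr (n + 1) a
  framing : ∀ (n : ℕ) (a : Y d n u) (s : ZMod d),
    tr (n + 1) (YokonumaHecke.incl d n u a * tpow u n (Nat.lt_succ_self n) s) = x s * tr n a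

/-- The shifted idempotent `e_i^{(m)} = d⁻¹ ∑_{s=0}^{d-1} t_i^{m+s} t_{i+1}^{d-s}`. -/
def eShift {d n : ℕ} (u : ℂ) (i : ℕ) (hi : i + 1 < n) (m : ZMod d) : Y d n u :=
  (1 / (d : ℂ)) • ∑ s ∈ Finset.range d,
    t d u i (Nat.lt_of_succ_lt hi) ^ (m.val + s) * t d u (i + 1) hi ^ (d - s)

/-- `E^{(m)} = d⁻¹ ∑_s x_{m+s} x_{d-s}`, the value of the trace at every `e_i^{(m)}`. -/
def EShift {d : ℕ} [NeZero d] (x : ZMod d → ℂ) (m : ZMod d) : ℂ :=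
  (1 / (d : ℂ)) * ∑ s : ZMod d, x (m + s) * x (-s)

/-- The Steinberg element `g_{i,i+1} = ∑ g_w`, over the six elements
`1, s_i, s_{i+1}, s_i s_{i+1}, s_{i+1} s_i, s_i s_{i+1} s_i` of the subgroup `⟨s_i, s_{i+1}⟩`. -/
def steinberg (d : ℕ) {n : ℕ} (u : ℂ) (i : ℕ) (hi : i + 2 < n) : Y d n u :=
  1 + g d u i (Nat.lt_of_succ_lt hi) + g d u (i + 1) hi
    + g d u i (Nat.lt_of_succ_lt hi) * g d u (i + 1) hi
    + g d u (i + 1) hi * g d u i (Nat.lt_of_succ_lt hi)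
    + g d u i (Nat.lt_of_succ_lt hi) * g d u (i + 1) hi * g d u i (Nat.lt_of_succ_lt hi)

/-- `r_{i,i+1} = ∑ g_h` over `h` in `⟨t_i t_{i+1}⁻¹, t_{i+1} t_{i+2}⁻¹⟩ ⋊ ⟨s_i, s_{i+1}⟩`: the
elements of this group are the `t_i^a t_{i+1}^{b-a} t_{i+2}^{-b} w`, each for exactly one choice of
`a, b` modulo `d` and `w`, and then `g_h = t_i^a t_{i+1}^{b-a} t_{i+2}^{-b} g_w`. -/
def rElt (d : ℕ) [NeZero d] {n : ℕ} (u : ℂ) (i : ℕ) (hi : i + 2 < n) : Y d n u :=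
  ∑ a : ZMod d, ∑ b : ZMod d,
    tpow u i (by omega) a * tpow u (i + 1) (by omega) (b - a) * tpow u (i + 2) hi (-b)
      * steinberg d u i hi

/-- `c_{i,i+1} = ∑ g_c` over `c` in `⟨t_i, t_{i+1}, t_{i+2}⟩ ⋊ ⟨s_i, s_{i+1}⟩`. -/
def cElt (d : ℕ) [NeZero d] {n : ℕ} (u : ℂ) (i : ℕ) (hi : i + 2 < n) : Y d n u :=
  ∑ a : ZMod d, ∑ b : ZMod d, ∑ c : ZMod d,
    tpow u i (by omega) a * tpow u (i + 1) (by omega) b * tpow u (i + 2) hi c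
      * steinberg d u i hi

/-- The two-sided ideal generated by all the `r_{i,i+1}`. -/
def ftlIdeal (d : ℕ) [NeZero d] (n : ℕ) (u : ℂ) : TwoSidedIdeal (Y d n u) :=
  TwoSidedIdeal.span {y | ∃ (i : ℕ) (hi : i + 2 < n), y = rElt d u i hi}

/-- The two-sided ideal generated by all the `c_{i,i+1}`. -/
def ctlIdeal (d : ℕ) [NeZero d] (n : ℕ) (u : ℂ) : TwoSidedIdeal (Y d n u) :=
  TwoSidedIdeal.span {y | ∃ (i : ℕ) (hi : i + 2 < n), y = cElt d u i hi}

/-- The Framization of the Temperley--Lieb algebra, `FTL_{d,n}(u)`. -/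
abbrev FTL (d : ℕ) [NeZero d] (n : ℕ) (u : ℂ) : Type := (ftlIdeal d n u).ringCon.Quotient

/-- The Complex Reflection Temperley--Lieb algebra, `CTL_{d,n}(u)`. -/
abbrev CTL (d : ℕ) [NeZero d] (n : ℕ) (u : ℂ) : Type := (ctlIdeal d n u).ringCon.Quotient

/-- A linear functional on `Y_{d,n}(u)` passes to `FTL_{d,n}(u)`: it factors through the canonical
projection. -/
def PassesToFTL {d : ℕ} [NeZero d] {n : ℕ} {u : ℂ} (τ : Y d n u →ₗ[ℂ] ℂ) : Prop :=
  ∃ f : FTL d n u →ₗ[ℂ] ℂ, f ∘ₗ ((ftlIdeal d n u).ringCon.mkₐ (α := ℂ)).toLinearMap = τ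

/-- A linear functional on `Y_{d,n}(u)` passes to `CTL_{d,n}(u)`: it factors through the canonical
projection. -/
def PassesToCTL {d : ℕ} [NeZero d] {n : ℕ} {u : ℂ} (τ : Y d n u →ₗ[ℂ] ℂ) : Prop :=
  ∃ f : CTL d n u →ₗ[ℂ] ℂ, f ∘ₗ ((ctlIdeal d n u).ringCon.mkₐ (α := ℂ)).toLinearMap = τ

/-- The parameters have the form
`x_k = -z (∑_{m ∈ S₁} χ(km) + (u+1) ∑_{m ∈ S₂} χ(km))` and `z = -1 / (|S₁| + (u+1)|S₂|)`, where
`χ(k) = exp(2πik/d)` and the support of the Fourier transform of `x` is the disjoint union of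
`S₁` and `S₂`. -/
def SupportCondition {d : ℕ} [NeZero d] (u z : ℂ) (x : ZMod d → ℂ) : Prop :=
  ∃ S₁ S₂ : Finset (ZMod d), Disjoint S₁ S₂ ∧
    (S₁ : Set (ZMod d)) ∪ S₂ = Function.support (ZMod.dft x) ∧
    (∀ k : ZMod d, x k = -z * (∑ m ∈ S₁, ZMod.stdAddChar (k * m)
      + (u + 1) * ∑ m ∈ S₂, ZMod.stdAddChar (k * m))) ∧
    (S₁.card : ℂ) + (u + 1) * S₂.card ≠ 0 ∧
    z = -1 / ((S₁.card : ℂ) + (u + 1) * S₂.card)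

end YokonumaHecke

end

/-! The sum over the framing subgroup factors, so r_{i,i+1} = d² e_i e_{i+1} g_{i,i+1} (`rElt_eq`).
Since e_i e_{i+1} turns the quadratic relations into Hecke relations and identifies the three
framings, g_i and g_{i+1} act on r_{i,i+1} from the left by the scalar u, and t_i, t_{i+1}, t_{i+2}
all act in the same way.

A trace kills a two-sided ideal iff it kills the left multiples of its generators
(`forall_mem_span_iff`). The r_{i,i+1} are conjugate (`rElt_succ`), so r_{1,2} suffices. In
Y_{d,3}(u) its left multiples are spanned by the t_1^k r_{1,2}; for larger n the inductive spanning
set and the Markov rules descend to n = 3 (`tr_mul_rElt_zero`). Evaluating tr(t_1^k r_{1,2}) gives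
d² times the left side of the k-th equation.

The products in these equations are convolutions, so the Fourier transform decouples them: each
value y of the transform satisfies y(y + dz)(y + dz(u+1)) = 0 (`equations_iff_dft`). The frequencies
with the two nonzero roots form S₁ and S₂; Fourier inversion gives x, and x_0 = 1 gives z. Finally
c_{i,i+1} is the sum of the t_i^k r_{i,i+1} (`cElt_eq`), so the CTL ideal lies in the FTL ideal. -/

namespace YokonumaHecke

/-! ### Defining relations in the quotient, and the tower maps on generators. -/

section Relations

variable {d n : ℕ} {u : ℂ}

theorem g_mul_g_comm (i j : ℕ) (hi : i + 1 < n) (hj : j + 1 < n) (hij : i + 1 < j ∨ j + 1 < i) :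
    g d u i hi * g d u j hj = g d u j hj * g d u i hi := by
  simpa only [map_mul] using! RingQuot.mkAlgHom_rel ℂ (Rel.g_comm (d := d) (u := u) i j hi hj hij)

theorem g_braid (i : ℕ) (hi : i + 2 < n) (h₀ : i + 1 < n) (h₁ : i + 1 + 1 < n) :
    g d u (i + 1) h₁ * g d u i h₀ * g d u (i + 1) h₁
      = g d u i h₀ * g d u (i + 1) h₁ * g d u i h₀ := by
  simpa only [map_mul] using! RingQuot.mkAlgHom_rel ℂ (Rel.braid (d := d) (u := u) i hi)

theorem t_mul_t_comm (i j : ℕ) (hi : i < n) (hj : j < n) :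
    t d u i hi * t d u j hj = t d u j hj * t d u i hi := by
  simpa only [map_mul] using! RingQuot.mkAlgHom_rel ℂ (Rel.t_comm (d := d) (u := u) i j hi hj)

theorem t_pow_eq_one (i : ℕ) (hi : i < n) : t d u i hi ^ d = 1 := by
  simpa only [map_pow, map_one] using! RingQuot.mkAlgHom_rel ℂ (Rel.t_pow (d := d) (u := u) i hi)

theorem g_mul_t (i : ℕ) (hi : i + 1 < n) (h₀ : i < n) :
    g d u i hi * t d u i h₀ = t d u (i + 1) hi * g d u i hi := by
  simpa only [map_mul] using! RingQuot.mkAlgHom_rel ℂ (Rel.g_t (d := d) (u := u) i hi)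

theorem g_mul_t_succ (i : ℕ) (hi : i + 1 < n) (h₀ : i < n) :
    g d u i hi * t d u (i + 1) hi = t d u i h₀ * g d u i hi := by
  simpa only [map_mul] using! RingQuot.mkAlgHom_rel ℂ (Rel.g_t_succ (d := d) (u := u) i hi)

theorem g_mul_t_of_ne (i j : ℕ) (hi : i + 1 < n) (hj : j < n) (h₁ : j ≠ i) (h₂ : j ≠ i + 1) :
    g d u i hi * t d u j hj = t d u j hj * g d u i hi := by
  simpa only [map_mul] using!
    RingQuot.mkAlgHom_rel ℂ (Rel.g_t_of_ne (d := d) (u := u) i j hi hj h₁ h₂)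

/-- A property of elements of `Y_{d,n}(u)` that holds for `1`, is linear and is stable under left
multiplication by generators holds for every element. -/
theorem submodule_eq_top (S : Submodule ℂ (Y d n u)) (one : (1 : Y d n u) ∈ S)
    (hg : ∀ i hi, ∀ a ∈ S, g d u i hi * a ∈ S) (ht : ∀ j hj, ∀ a ∈ S, t d u j hj * a ∈ S)
    (a : Y d n u) : a ∈ S := by
  obtain ⟨w, rfl⟩ := RingQuot.mkAlgHom_surjective ℂ (Rel d n u) a
  -- Quantifying over all b in S lets the induction on words pass through products.
  suffices h : ∀ b ∈ S, RingQuot.mkAlgHom ℂ (Rel d n u) w * b ∈ S by simpa using h 1 one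
  induction w using FreeAlgebra.induction with
  | grade0 r =>
    intro b hb
    rw [AlgHom.commutes, ← Algebra.smul_def]
    exact S.smul_mem r hb
  | grade1 a =>
    cases a with
    | g i hi => exact hg i hi
    | t j hj => exact ht j hj
  | mul a b ha hb =>
    intro c hc
    rw [map_mul, mul_assoc]
    exact ha _ (hb c hc)
  | add a b ha hb =>
    intro c hc
    rw [map_add, add_mul]
    exact S.add_mem (ha c hc) (hb c hc)

theorem incl_g (i : ℕ) (hi : i + 1 < n) :
    incl d n u (g d u i hi) = g d u i (Nat.lt_succ_of_lt hi) := by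
  exact (RingQuot.liftAlgHom_mkAlgHom_apply ℂ _ _ _).trans (by simp [freeIncl_fg, g])

theorem incl_t (j : ℕ) (hj : j < n) :
    incl d n u (t d u j hj) = t d u j (Nat.lt_succ_of_lt hj) := by
  exact (RingQuot.liftAlgHom_mkAlgHom_apply ℂ _ _ _).trans (by simp [freeIncl_ft, t])

theorem incl_tpow (j : ℕ) (hj : j < n) (s : ZMod d) :
    incl d n u (tpow u j hj s) = tpow u j (Nat.lt_succ_of_lt hj) s := by
  simp [tpow, incl_t]

theorem incl_eShift (i : ℕ) (hi : i + 1 < n) (m : ZMod d) :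
    incl d n u (eShift u i hi m) = eShift u i (Nat.lt_succ_of_lt hi) m := by
  simp [eShift, incl_t]

theorem incl_steinberg (i : ℕ) (hi : i + 2 < n) :
    incl d n u (steinberg d u i hi) = steinberg d u i (Nat.lt_succ_of_lt hi) := by
  simp [steinberg, incl_g]

theorem incl_rElt [NeZero d] (i : ℕ) (hi : i + 2 < n) :
    incl d n u (rElt d u i hi) = rElt d u i (Nat.lt_succ_of_lt hi) := by
  simp [rElt, incl_tpow, incl_steinberg]

theorem t_pow_eq_tpow (j : ℕ) (hj : j < n) (k : ℕ) : t d u j hj ^ k = tpow u j hj (k : ZMod d) := by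
  rw [tpow, ZMod.val_natCast, ← pow_eq_pow_mod k (t_pow_eq_one j hj)]

theorem tpow_zero (j : ℕ) (hj : j < n) : (tpow u j hj (0 : ZMod d) : Y d n u) = 1 := by
  simp [tpow]

theorem tpow_comm (i j : ℕ) (hi : i < n) (hj : j < n) (a b : ZMod d) :
    (tpow u i hi a * tpow u j hj b : Y d n u) = tpow u j hj b * tpow u i hi a :=
  Commute.pow_pow (t_mul_t_comm i j hi hj) _ _

theorem g_mul_tpow (i : ℕ) (hi : i + 1 < n) (h₀ : i < n) (a : ZMod d) :
    g d u i hi * tpow u i h₀ a = tpow u (i + 1) hi a * g d u i hi :=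
  SemiconjBy.pow_right (g_mul_t i hi h₀) _

theorem g_mul_tpow_succ (i : ℕ) (hi : i + 1 < n) (h₀ : i < n) (a : ZMod d) :
    g d u i hi * tpow u (i + 1) hi a = tpow u i h₀ a * g d u i hi :=
  SemiconjBy.pow_right (g_mul_t_succ i hi h₀) _

theorem g_mul_tpow_of_ne (i j : ℕ) (hi : i + 1 < n) (hj : j < n) (h₁ : j ≠ i) (h₂ : j ≠ i + 1)
    (a : ZMod d) : g d u i hi * tpow u j hj a = tpow u j hj a * g d u i hi :=
  SemiconjBy.pow_right (g_mul_t_of_ne i j hi hj h₁ h₂) _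

theorem g_mul_g (i : ℕ) (hi : i + 1 < n) :
    g d u i hi * g d u i hi = 1 + (u - 1) • eShift u i hi 0
      + (u - 1) • (eShift u i hi 0 * g d u i hi) := by
  have h := RingQuot.mkAlgHom_rel ℂ (Rel.quadratic (d := d) (u := u) i hi)
  have he : RingQuot.mkAlgHom ℂ (Rel d n u) (fe d i hi) = eShift u i hi 0 := by
    simp [fe, eShift, t]
  simpa only [map_add, map_mul, map_pow, map_one, map_smul, he, pow_two] using! h

theorem t_eq_tpow (j : ℕ) (hj : j < n) : t d u j hj = tpow u j hj (1 : ZMod d) := by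
  simpa using! t_pow_eq_tpow (d := d) (u := u) j hj 1

end Relations

/-! ### The idempotents e_i and the invertibility of g_i. -/

section Framing

variable {d n : ℕ} [NeZero d] {u : ℂ}

theorem tpow_add (j : ℕ) (hj : j < n) (a b : ZMod d) :
    (tpow u j hj (a + b) : Y d n u) = tpow u j hj a * tpow u j hj b := by
  rw [tpow, tpow, tpow, ← pow_add, ZMod.val_add, ← pow_eq_pow_mod _ (t_pow_eq_one j hj)]

theorem sum_range_eq_sum_zmod {M : Type*} [AddCommMonoid M] (f : ℕ → M) :
    ∑ s ∈ Finset.range d, f s = ∑ s : ZMod d, f s.val := by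
  obtain ⟨k, rfl⟩ := Nat.exists_eq_succ_of_ne_zero (NeZero.ne d)
  exact Finset.sum_range f

theorem eShift_eq_sum (i : ℕ) (hi : i + 1 < n) (h₀ : i < n) (m : ZMod d) :
    eShift u i hi m = (1 / (d : ℂ)) • ∑ s : ZMod d,
      (tpow u i h₀ (m + s) * tpow u (i + 1) hi (-s) : Y d n u) := by
  rw [eShift, sum_range_eq_sum_zmod]
  congr 1
  refine Finset.sum_congr rfl fun s _ => ?_
  rw [t_pow_eq_tpow, t_pow_eq_tpow, Nat.cast_sub s.val_le]
  simp

theorem eShift_eq_mul (i : ℕ) (hi : i + 1 < n) (h₀ : i < n) (m : ZMod d) :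
    (eShift u i hi m : Y d n u) = tpow u i h₀ m * eShift u i hi 0 := by
  simp only [eShift_eq_sum i hi h₀, mul_smul_comm, Finset.mul_sum, tpow_add, tpow_zero, mul_assoc,
    one_mul]

/-- Multiplication by a framing power only shifts the summation index of e_i. This is what makes e_i
idempotent and the framings indistinguishable on r_{i,i+1}. -/
theorem tpow_succ_mul_e (i : ℕ) (hi : i + 1 < n) (h₀ : i < n) (m : ZMod d) :
    (tpow u (i + 1) hi m * eShift u i hi 0 : Y d n u) = tpow u i h₀ m * eShift u i hi 0 := by
  simp only [eShift_eq_sum i hi h₀, mul_smul_comm, Finset.mul_sum, zero_add]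
  congr 1
  rw [← Equiv.sum_comp (Equiv.addRight m)]
  refine Finset.sum_congr rfl fun s _ => ?_
  rw [← mul_assoc, tpow_comm, mul_assoc, ← tpow_add, ← mul_assoc, ← tpow_add]
  simp [add_comm m s]

theorem tpow_comm_e (i j : ℕ) (hi : i + 1 < n) (hj : j < n) (m : ZMod d) :
    (tpow u j hj m * eShift u i hi 0 : Y d n u) = eShift u i hi 0 * tpow u j hj m := by
  simp only [eShift_eq_sum i hi (by omega), mul_smul_comm, smul_mul_assoc, Finset.mul_sum,
    Finset.sum_mul]
  congr 1
  refine Finset.sum_congr rfl fun s _ => ?_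
  rw [← mul_assoc, tpow_comm j i, mul_assoc, tpow_comm j (i + 1), mul_assoc]

theorem e_comm_e (i j : ℕ) (hi : i + 1 < n) (hj : j + 1 < n) :
    (eShift u j hj 0 * eShift u i hi (0 : ZMod d) : Y d n u)
      = eShift u i hi 0 * eShift u j hj 0 := by
  rw [eShift_eq_sum j hj (by omega)]
  simp only [mul_smul_comm, smul_mul_assoc, Finset.mul_sum, Finset.sum_mul]
  congr 1
  refine Finset.sum_congr rfl fun s _ => ?_
  rw [mul_assoc, tpow_comm_e, ← mul_assoc, tpow_comm_e, mul_assoc]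

theorem e_mul_self (i : ℕ) (hi : i + 1 < n) :
    (eShift u i hi (0 : ZMod d) * eShift u i hi 0 : Y d n u) = eShift u i hi 0 := by
  conv_lhs => enter [1]; rw [eShift_eq_sum i hi (by omega)]
  have h : ∀ s : ZMod d, (tpow u i (by omega) (0 + s) * tpow u (i + 1) hi (-s)
      * eShift u i hi 0 : Y d n u) = eShift u i hi 0 := fun s => by
    rw [mul_assoc, tpow_succ_mul_e i hi (by omega), ← mul_assoc, ← tpow_add, zero_add,
      add_neg_cancel, tpow_zero, one_mul]
  simp only [smul_mul_assoc, Finset.sum_mul, h, Finset.sum_const, Finset.card_univ, ZMod.card]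
  rw [← Nat.cast_smul_eq_nsmul ℂ, smul_smul, one_div, inv_mul_cancel₀ (NeZero.ne _), one_smul]

theorem g_comm_e (i : ℕ) (hi : i + 1 < n) :
    (g d u i hi * eShift u i hi 0 : Y d n u) = eShift u i hi 0 * g d u i hi := by
  simp only [eShift_eq_sum i hi (by omega), mul_smul_comm, smul_mul_assoc, Finset.mul_sum,
    Finset.sum_mul]
  congr 1
  rw [← Equiv.sum_comp (Equiv.neg _)]
  refine Finset.sum_congr rfl fun s _ => ?_
  rw [← mul_assoc, g_mul_tpow, mul_assoc, g_mul_tpow_succ i hi (by omega), ← mul_assoc, tpow_comm]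
  simp

theorem e_mul_g_mul_g (i : ℕ) (hi : i + 1 < n) :
    eShift u i hi 0 * (g d u i hi * g d u i hi)
      = u • eShift u i hi 0 + (u - 1) • (eShift u i hi 0 * g d u i hi) := by
  rw [g_mul_g, mul_add, mul_add, mul_one, mul_smul_comm, mul_smul_comm, ← mul_assoc, e_mul_self]
  module

/-- Off e_i the relation reads g_i² = 1, so g_i is its own inverse there; on e_i it reads (g_i -
u)(g_i + 1) = 0, with inverse u⁻¹(g_i + 1 - u). The candidate inverse combines the two. -/
theorem isUnit_g (hu : u ≠ 0) (i : ℕ) (hi : i + 1 < n) : IsUnit (g d u i hi) := by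
  have h : g d u i hi * (g d u i hi + (u⁻¹ - 1) • eShift u i hi 0
      + (u⁻¹ - 1) • (eShift u i hi 0 * g d u i hi)) = 1 := by
    have h1 : g d u i hi * (eShift u i hi 0 * g d u i hi) = u • eShift u i hi 0
      + (u - 1) • (eShift u i hi 0 * g d u i hi) := by
      rw [← mul_assoc, g_comm_e, mul_assoc, e_mul_g_mul_g]
    rw [mul_add, mul_add, mul_smul_comm, mul_smul_comm, h1, g_mul_g, g_comm_e]
    have h2 : ∀ {M : Type} [AddCommGroup M] [Module ℂ M] (a b c : M),
        a + (u - 1) • b + (u - 1) • c + (u⁻¹ - 1) • c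
          + (u⁻¹ - 1) • (u • b + (u - 1) • c) = a := fun a b c => by
      match_scalars <;> field_simp <;> ring
    exact h2 _ _ _
  have h' : (g d u i hi + (u⁻¹ - 1) • eShift u i hi 0
      + (u⁻¹ - 1) • (eShift u i hi 0 * g d u i hi)) * g d u i hi = 1 := by
    rw [← h]
    simp only [add_mul, mul_add, mul_smul_comm, smul_mul_assoc, g_comm_e, ← mul_assoc]
  exact ⟨⟨_, _, h, h'⟩, rfl⟩

end Framing

/-! ### The elements r_{i,i+1}: factorization, left action of the generators, conjugacy. -/

section Steinberg

variable {d n : ℕ} [NeZero d] {u : ℂ}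

theorem sum_tpow_eq (i : ℕ) (hi : i + 2 < n) (h₀ : i < n) (h₁ : i + 1 < n) :
    (∑ a : ZMod d, ∑ b : ZMod d,
      tpow u i h₀ a * tpow u (i + 1) h₁ (b - a) * tpow u (i + 2) hi (-b) : Y d n u)
      = (d : ℂ) ^ 2 • (eShift u i h₁ 0 * eShift u (i + 1) hi 0) := by
  rw [eShift_eq_sum i h₁ h₀, eShift_eq_sum (i + 1) hi h₁, smul_mul_smul_comm, smul_smul,
    Finset.sum_mul_sum]
  have : (d : ℂ) ^ 2 * (1 / d * (1 / d)) = 1 := by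
    have : (d : ℂ) ≠ 0 := NeZero.ne _
    field_simp
  rw [this, one_smul]
  refine Finset.sum_congr rfl fun a _ => Finset.sum_congr rfl fun b _ => ?_
  rw [zero_add, zero_add, sub_eq_neg_add, tpow_add]
  simp only [mul_assoc]

/-- Conjugation by g_i swaps the first two framings, which permutes the framing subgroup by a ↦ b -
a. Scaling by d² restores the plain sum over that subgroup. -/
theorem g_comm_e_mul_e (i : ℕ) (hi : i + 2 < n) (h₁ : i + 1 < n) :
    g d u i h₁ * (eShift u i h₁ 0 * eShift u (i + 1) hi 0)
      = eShift u i h₁ 0 * eShift u (i + 1) hi 0 * g d u i h₁ := by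
  have hd : (d : ℂ) ^ 2 ≠ 0 := pow_ne_zero _ (NeZero.ne _)
  refine smul_right_injective _ hd ?_
  simp only
  rw [← mul_smul_comm, ← smul_mul_assoc ((d : ℂ) ^ 2) (_ * _), ← sum_tpow_eq i hi (by omega) h₁]
  simp only [Finset.mul_sum, Finset.sum_mul]
  conv_rhs => rw [Finset.sum_comm]
  conv_lhs => rw [Finset.sum_comm]
  refine Finset.sum_congr rfl fun b _ => ?_
  rw [← Equiv.sum_comp (Equiv.subLeft b)]
  refine Finset.sum_congr rfl fun a _ => ?_
  rw [mul_assoc _ _ (g d u i h₁), ← g_mul_tpow_of_ne i (i + 2) h₁ hi (by omega) (by omega),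
    ← mul_assoc, ← mul_assoc, ← mul_assoc, g_mul_tpow, mul_assoc _ (g d u i h₁),
    g_mul_tpow_succ i h₁ (by omega), ← mul_assoc, tpow_comm]
  simp

theorem g_succ_comm_e_mul_e (i : ℕ) (hi : i + 2 < n) (h₁ : i + 1 < n) :
    g d u (i + 1) hi * (eShift u i h₁ 0 * eShift u (i + 1) hi 0)
      = eShift u i h₁ 0 * eShift u (i + 1) hi 0 * g d u (i + 1) hi := by
  have hd : (d : ℂ) ^ 2 ≠ 0 := pow_ne_zero _ (NeZero.ne _)
  refine smul_right_injective _ hd ?_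
  simp only
  rw [← mul_smul_comm, ← smul_mul_assoc ((d : ℂ) ^ 2) (_ * _), ← sum_tpow_eq i hi (by omega) h₁]
  simp only [Finset.mul_sum, Finset.sum_mul]
  refine Finset.sum_congr rfl fun a _ => ?_
  rw [← Equiv.sum_comp (Equiv.subLeft a)]
  refine Finset.sum_congr rfl fun b _ => ?_
  rw [← mul_assoc, ← mul_assoc, g_mul_tpow_of_ne (i + 1) i _ _ (by omega) (by omega),
    mul_assoc _ (g d u (i + 1) hi), g_mul_tpow, mul_assoc _ _ (tpow u (i + 2) hi _),
    mul_assoc _ (g d u (i + 1) hi), g_mul_tpow_succ (i + 1) hi h₁, ← mul_assoc, ← mul_assoc,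
    mul_assoc _ _ (tpow u (i + 1) h₁ _), tpow_comm, ← mul_assoc]
  simp

theorem rElt_eq (i : ℕ) (hi : i + 2 < n) (h₁ : i + 1 < n) :
    rElt d u i hi = (d : ℂ) ^ 2 • (eShift u i h₁ 0 * eShift u (i + 1) hi 0 * steinberg d u i hi) := by
  simp only [rElt]
  rw [← smul_mul_assoc, ← sum_tpow_eq i hi (by omega) h₁]
  simp only [Finset.sum_mul]

/-- If `f` commutes with `a` and `f a² = u f + (u-1) f a`, then `a f (1 + a) = u f (1 + a)`. -/
theorem mul_mul_one_add {A : Type*} [Ring A] [Algebra ℂ A] {f a : A} (h : a * f = f * a)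
    (h2 : f * (a * a) = u • f + (u - 1) • (f * a)) :
    a * (f * (1 + a)) = u • (f * (1 + a)) := by
  rw [← mul_assoc, h, mul_assoc, mul_add, mul_add, h2, mul_add, mul_one, mul_one]
  module

/-- The Steinberg element has 1 + g_i as a left factor, and under e_i e_{i+1} the Hecke relation
makes this factor an eigenvector of g_i with eigenvalue u. -/
theorem g_mul_rElt (i : ℕ) (hi : i + 2 < n) (h₁ : i + 1 < n) :
    g d u i h₁ * rElt d u i hi = u • rElt d u i hi := by
  have hs : steinberg d u i hi = (1 + g d u i h₁) * (1 + g d u (i + 1) hi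
      + g d u (i + 1) hi * g d u i h₁) := by
    simp only [steinberg, mul_add, add_mul, one_mul, mul_one, mul_assoc]
    abel
  have h2 : eShift u i h₁ 0 * eShift u (i + 1) hi 0 * (g d u i h₁ * g d u i h₁)
      = u • (eShift u i h₁ 0 * eShift u (i + 1) hi 0)
        + (u - 1) • (eShift u i h₁ 0 * eShift u (i + 1) hi 0 * g d u i h₁) := by
    rw [← e_comm_e, mul_assoc, e_mul_g_mul_g, mul_add, mul_smul_comm, mul_smul_comm, mul_assoc]
  rw [rElt_eq i hi h₁, hs, ← mul_assoc _ (1 + _), mul_smul_comm, ← mul_assoc,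
    mul_mul_one_add (g_comm_e_mul_e i hi h₁) h2, smul_mul_assoc, smul_comm]

theorem g_succ_mul_rElt (i : ℕ) (hi : i + 2 < n) :
    g d u (i + 1) hi * rElt d u i hi = u • rElt d u i hi := by
  have h₁ : i + 1 < n := by omega
  -- Extracting 1 + g_{i+1} instead requires the braid relation for the longest word.
  have hs : steinberg d u i hi = (1 + g d u (i + 1) hi) * (1 + g d u i h₁
      + g d u i h₁ * g d u (i + 1) hi) := by
    simp only [steinberg, mul_add, add_mul, one_mul, mul_one, ← mul_assoc, g_braid i hi]
    abel
  have h2 : eShift u i h₁ 0 * eShift u (i + 1) hi 0 * (g d u (i + 1) hi * g d u (i + 1) hi)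
      = u • (eShift u i h₁ 0 * eShift u (i + 1) hi 0)
        + (u - 1) • (eShift u i h₁ 0 * eShift u (i + 1) hi 0 * g d u (i + 1) hi) := by
    rw [mul_assoc, e_mul_g_mul_g, mul_add, mul_smul_comm, mul_smul_comm, mul_assoc]
  rw [rElt_eq i hi h₁, hs, ← mul_assoc _ (1 + _), mul_smul_comm, ← mul_assoc,
    mul_mul_one_add (g_succ_comm_e_mul_e i hi h₁) h2, smul_mul_assoc, smul_comm]

theorem tpow_succ_mul_rElt (i : ℕ) (hi : i + 2 < n) (h₀ : i < n) (h₁ : i + 1 < n) (m : ZMod d) :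
    tpow u (i + 1) h₁ m * rElt d u i hi = tpow u i h₀ m * rElt d u i hi := by
  rw [rElt_eq i hi h₁, mul_smul_comm, mul_smul_comm]
  simp only [← mul_assoc]
  rw [tpow_succ_mul_e i h₁ h₀]

theorem tpow_succ_succ_mul_rElt (i : ℕ) (hi : i + 2 < n) (h₀ : i < n) (m : ZMod d) :
    tpow u (i + 2) hi m * rElt d u i hi = tpow u i h₀ m * rElt d u i hi := by
  rw [← tpow_succ_mul_rElt i hi h₀ (by omega), rElt_eq i hi (by omega), mul_smul_comm,
    mul_smul_comm, ← e_comm_e]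
  simp only [← mul_assoc]
  rw [tpow_succ_mul_e (i + 1) hi (by omega)]

/-- All framings act alike on r_{i,i+1}; acting through the third one makes the comparison a shift
of each exponent. -/
theorem cElt_eq (i : ℕ) (hi : i + 2 < n) (h₀ : i < n) :
    cElt d u i hi = ∑ k : ZMod d, tpow u i h₀ k * rElt d u i hi := by
  have h₁ : i + 1 < n := by omega
  have h : ∀ k, tpow u i h₀ k * rElt d u i hi = tpow u (i + 2) hi k * rElt d u i hi := fun k =>
    (tpow_succ_succ_mul_rElt i hi h₀ k).symm
  simp only [h]
  simp only [cElt, rElt, Finset.mul_sum]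
  conv_rhs => rw [Finset.sum_comm]
  refine Finset.sum_congr rfl fun a _ => ?_
  conv_rhs => rw [Finset.sum_comm]
  rw [← Equiv.sum_comp (Equiv.subRight a)]
  refine Finset.sum_congr rfl fun b _ => ?_
  rw [← Equiv.sum_comp (Equiv.subRight b)]
  refine Finset.sum_congr rfl fun c _ => ?_
  simp only [Equiv.subRight_apply]
  rw [sub_eq_add_neg c b, tpow_add, ← mul_assoc (tpow u (i + 2) hi c),
    ← mul_assoc (tpow u (i + 2) hi c), ← mul_assoc (tpow u (i + 2) hi c),
    tpow_comm (i + 2) i, mul_assoc _ (tpow u (i + 2) hi c), tpow_comm (i + 2) (i + 1)]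
  simp only [mul_assoc]

/-- The product `g_i g_{i+1} g_{i+2}` conjugates `r_{i,i+1}` into `r_{i+1,i+2}`. -/
theorem rElt_succ (hu : u ≠ 0) (i : ℕ) (hi : i + 1 + 2 < n) (hi' : i + 2 < n) :
    ∃ p q : Y d n u, rElt d u (i + 1) hi = p * rElt d u i hi' * q := by
  have h₁ : i + 1 < n := by omega
  have h₀ : i < n := by omega
  -- Conjugation by D raises the index of every generator occurring in r_{i,i+1} by one.
  let D := g d u i h₁ * g d u (i + 1) hi' * g d u (i + 2) hi
  have hD : IsUnit D := ((isUnit_g hu _ _).mul (isUnit_g hu _ _)).mul (isUnit_g hu _ _)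
  have ht0 (s) : SemiconjBy D (tpow u i h₀ s) (tpow u (i + 1) h₁ s) :=
    ((SemiconjBy.mul_left (g_mul_tpow i h₁ h₀ s)
      (g_mul_tpow_of_ne (i + 1) i hi' h₀ (by omega) (by omega) s))).mul_left
        (g_mul_tpow_of_ne (i + 2) i hi h₀ (by omega) (by omega) s)
  have ht1 (s) : SemiconjBy D (tpow u (i + 1) h₁ s) (tpow u (i + 2) hi' s) :=
    ((SemiconjBy.mul_left (g_mul_tpow_of_ne i (i + 2) h₁ hi' (by omega) (by omega) s)
      (g_mul_tpow (i + 1) hi' h₁ s))).mul_left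
        (g_mul_tpow_of_ne (i + 2) (i + 1) hi h₁ (by omega) (by omega) s)
  have ht2 (s) : SemiconjBy D (tpow u (i + 2) hi' s) (tpow u (i + 3) hi s) :=
    ((SemiconjBy.mul_left (g_mul_tpow_of_ne i (i + 3) h₁ hi (by omega) (by omega) s)
      (g_mul_tpow_of_ne (i + 1) (i + 3) hi' hi (by omega) (by omega) s))).mul_left
        (g_mul_tpow (i + 2) hi hi' s)
  have hg0 : SemiconjBy D (g d u i h₁) (g d u (i + 1) hi') :=
    SemiconjBy.mul_left (y := g d u i h₁)
      ((g_braid i hi' h₁ hi').symm.trans (mul_assoc _ _ _))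
      (g_mul_g_comm (i + 2) i hi h₁ (by omega))
  have hg1 : SemiconjBy D (g d u (i + 1) hi') (g d u (i + 2) hi) := by
    have h : SemiconjBy (g d u (i + 1) hi' * g d u (i + 2) hi) (g d u (i + 1) hi')
        (g d u (i + 2) hi) := (g_braid (i + 1) hi hi' hi).symm.trans (mul_assoc _ _ _)
    simpa only [D, mul_assoc] using!
      SemiconjBy.mul_left (g_mul_g_comm i (i + 2) h₁ hi (by omega)) h
  have hs : SemiconjBy D (steinberg d u i hi') (steinberg d u (i + 1) hi) :=
    (((((SemiconjBy.one_right D).add_right hg0).add_right hg1).add_right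
      (hg0.mul_right hg1)).add_right (hg1.mul_right hg0)).add_right
        ((hg0.mul_right hg1).mul_right hg0)
  have hr : D * rElt d u i hi' = rElt d u (i + 1) hi * D := by
    simp only [rElt, Finset.mul_sum, Finset.sum_mul]
    refine Finset.sum_congr rfl fun a _ => Finset.sum_congr rfl fun b _ => ?_
    exact (((ht0 a).mul_right (ht1 (b - a))).mul_right (ht2 (-b))).mul_right hs
  obtain ⟨v, hv⟩ := hD
  refine ⟨D, ↑v⁻¹, ?_⟩
  rw [hr, ← hv, mul_assoc, v.mul_inv, mul_one]

end Steinberg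

/-- An element that commutes with the images of the generators commutes with the whole image of an
algebra morphism. -/
theorem commute_algHom {d n : ℕ} {u : ℂ} {B : Type*} [Ring B] [Algebra ℂ B] (φ : Y d n u →ₐ[ℂ] B)
    (b : B) (hg : ∀ i hi, Commute b (φ (g d u i hi))) (ht : ∀ j hj, Commute b (φ (t d u j hj)))
    (a : Y d n u) : Commute b (φ a) := by
  let S : Submodule ℂ (Y d n u) :=
    Subalgebra.toSubmodule ((Subalgebra.centralizer ℂ {b}).comap φ)
  have hS : ∀ a, a ∈ S ↔ Commute b (φ a) := fun a => by
    simp [S, Subalgebra.mem_centralizer_iff, Commute, SemiconjBy]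
  refine (hS a).1 (submodule_eq_top S ?_ (fun i hi a ha => ?_) (fun j hj a ha => ?_) a)
  · rw [hS, map_one]
    exact Commute.one_right b
  · rw [hS] at ha ⊢
    rw [map_mul]
    exact (hg i hi).mul_right ha
  · rw [hS] at ha ⊢
    rw [map_mul]
    exact (ht j hj).mul_right ha

theorem g_last_commute_incl_incl {d n : ℕ} {u : ℂ} (a : Y d n u) :
    Commute (g d u n (Nat.lt_succ_self (n + 1))) (incl d (n + 1) u (incl d n u a)) := by
  refine commute_algHom ((incl d (n + 1) u).comp (incl d n u)) _ (fun i hi => ?_)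
    (fun j hj => ?_) a
  · rw [AlgHom.comp_apply, incl_g, incl_g]
    exact g_mul_g_comm _ _ _ _ (by omega)
  · rw [AlgHom.comp_apply, incl_t, incl_t]
    exact g_mul_t_of_ne _ _ _ _ (by omega) (by omega)

theorem tpow_last_commute_incl {d n : ℕ} {u : ℂ} (s : ZMod d) (a : Y d n u) :
    Commute (tpow u n (Nat.lt_succ_self n) s) (incl d n u a) := by
  refine commute_algHom _ _ (fun i hi => ?_) (fun j hj => ?_) a
  · rw [incl_g]
    exact (g_mul_tpow_of_ne i n _ _ (by omega) (by omega) s).symm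
  · rw [incl_t, t_eq_tpow]
    exact tpow_comm _ _ _ _ _ _

/-! ### Inductive spanning set of the next algebra in the tower. -/

section Spanning

variable {d n : ℕ} [NeZero d] {u : ℂ}

/-- The elements `a t_{n+1}^s` and `a g_n b` with `a, b` from `Y_{d,n}(u)`, of `Y_{d,n+1}(u)`. -/
def spanningSet (d n : ℕ) [NeZero d] (u : ℂ) : Set (Y d (n + 1) u) :=
  {y | ∃ (a : Y d n u) (s : ZMod d), y = incl d n u a * tpow u n (Nat.lt_succ_self n) s} ∪
  {y | ∃ (i : ℕ) (hi : i + 1 < n + 1) (_ : i + 1 = n) (a b : Y d n u),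
    y = incl d n u a * g d u i hi * incl d n u b}

theorem incl_mul_mem_span (c : Y d n u) {y : Y d (n + 1) u}
    (hy : y ∈ Submodule.span ℂ (spanningSet d n u)) :
    incl d n u c * y ∈ Submodule.span ℂ (spanningSet d n u) := by
  induction hy using Submodule.span_induction with
  | mem y hy =>
    refine Submodule.subset_span ?_
    rcases hy with ⟨a, s, rfl⟩ | ⟨i, hi, hin, a, b, rfl⟩
    · exact Or.inl ⟨c * a, s, by rw [map_mul, mul_assoc]⟩
    · exact Or.inr ⟨i, hi, hin, c * a, b, by simp only [map_mul, mul_assoc]⟩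
  | zero => rw [mul_zero]; exact Submodule.zero_mem _
  | add x y _ _ hx hy => rw [mul_add]; exact Submodule.add_mem _ hx hy
  | smul r x _ hx => rw [mul_smul_comm]; exact Submodule.smul_mem _ r hx

theorem mul_incl_mem_span (c : Y d n u) {y : Y d (n + 1) u}
    (hy : y ∈ Submodule.span ℂ (spanningSet d n u)) :
    y * incl d n u c ∈ Submodule.span ℂ (spanningSet d n u) := by
  induction hy using Submodule.span_induction with
  | mem y hy =>
    refine Submodule.subset_span ?_
    rcases hy with ⟨a, s, rfl⟩ | ⟨i, hi, hin, a, b, rfl⟩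
    · exact Or.inl ⟨a * c, s, by
        rw [map_mul, mul_assoc, (tpow_last_commute_incl s c).eq, mul_assoc]⟩
    · exact Or.inr ⟨i, hi, hin, a, b * c, by simp only [map_mul, mul_assoc]⟩
  | zero => rw [zero_mul]; exact Submodule.zero_mem _
  | add x y _ _ hx hy => rw [add_mul]; exact Submodule.add_mem _ hx hy
  | smul r x _ hx => rw [smul_mul_assoc]; exact Submodule.smul_mem _ r hx

theorem tpow_mem_span (s : ZMod d) :
    tpow u n (Nat.lt_succ_self n) s ∈ Submodule.span ℂ (spanningSet d n u) :=
  Submodule.subset_span (Or.inl ⟨1, s, by rw [map_one, one_mul]⟩)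

theorem g_mem_span :
    g d u n (Nat.lt_succ_self (n + 1)) ∈ Submodule.span ℂ (spanningSet d (n + 1) u) :=
  Submodule.subset_span (Or.inr ⟨n, Nat.lt_succ_self (n + 1), rfl, 1, 1, by
    simp only [map_one, one_mul, mul_one]⟩)

theorem tpow_mul_mem_span (s : ZMod d) {y : Y d (n + 1) u}
    (hy : y ∈ Submodule.span ℂ (spanningSet d n u)) :
    tpow u n (Nat.lt_succ_self n) s * y ∈ Submodule.span ℂ (spanningSet d n u) := by
  induction hy using Submodule.span_induction with
  | mem y hy =>
    refine Submodule.subset_span ?_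
    rcases hy with ⟨a, r, rfl⟩ | ⟨i, hi, hin, a, b, rfl⟩
    · exact Or.inl ⟨a, s + r, by
        rw [← mul_assoc, (tpow_last_commute_incl s a).eq, mul_assoc, ← tpow_add]⟩
    · subst hin
      refine Or.inr ⟨i, hi, rfl, a, tpow u i (Nat.lt_succ_self i) s * b, ?_⟩
      rw [map_mul, incl_tpow, ← mul_assoc, ← mul_assoc, (tpow_last_commute_incl s a).eq,
        mul_assoc _ (tpow u (i + 1) _ s), ← g_mul_tpow i hi (by omega)]
      simp only [mul_assoc]
  | zero => rw [mul_zero]; exact Submodule.zero_mem _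
  | add x y _ _ hx hy => rw [mul_add]; exact Submodule.add_mem _ hx hy
  | smul r x _ hx => rw [mul_smul_comm]; exact Submodule.smul_mem _ r hx

/-- The quadratic relation removes the second copy of the last g. This is the case of
`mem_span_spanningSet` where only a framing stood between the two copies. -/
theorem tpow_mul_g_mul_g_mem_span (s : ZMod d) :
    tpow u (n + 1) (Nat.lt_succ_self (n + 1)) s
      * (g d u n (Nat.lt_succ_self (n + 1)) * g d u n (Nat.lt_succ_self (n + 1)))
      ∈ Submodule.span ℂ (spanningSet d (n + 1) u) := by
  refine tpow_mul_mem_span s ?_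
  have he : ∀ y ∈ Submodule.span ℂ (spanningSet d (n + 1) u),
      eShift u n (Nat.lt_succ_self (n + 1)) 0 * y
        ∈ Submodule.span ℂ (spanningSet d (n + 1) u) := fun y hy => by
    rw [eShift_eq_sum n (Nat.lt_succ_self (n + 1)) (by omega), smul_mul_assoc, Finset.sum_mul]
    refine Submodule.smul_mem _ _ (Submodule.sum_mem _ fun r _ => ?_)
    rw [mul_assoc, ← incl_tpow n (Nat.lt_succ_self n)]
    exact incl_mul_mem_span _ (tpow_mul_mem_span _ hy)
  have h1 : (1 : Y d (n + 1 + 1) u) ∈ Submodule.span ℂ (spanningSet d (n + 1) u) := by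
    rw [← tpow_zero (d := d) (n + 1) (Nat.lt_succ_self (n + 1))]
    exact tpow_mem_span 0
  rw [g_mul_g]
  refine Submodule.add_mem _ (Submodule.add_mem _ h1 (Submodule.smul_mem _ _ ?_))
    (Submodule.smul_mem _ _ (he _ g_mem_span))
  simpa only [mul_one] using he 1 h1

/-- The spanning set of `Y_{d,n+1}(u)` that underlies the inductive definition of the trace. -/
theorem mem_span_spanningSet (y : Y d (n + 1) u) :
    y ∈ Submodule.span ℂ (spanningSet d n u) := by
  induction n with
  | zero =>
    refine submodule_eq_top _ ?_ (fun i hi => by omega) (fun j hj a ha => ?_) y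
    · rw [← tpow_zero (d := d) 0 (Nat.lt_succ_self 0)]
      exact tpow_mem_span 0
    · obtain rfl : j = 0 := by omega
      rw [t_eq_tpow]
      exact tpow_mul_mem_span 1 ha
  | succ n ih =>
    refine submodule_eq_top _ ?_ (fun i hi a ha => ?_) (fun j hj a ha => ?_) y
    · rw [← tpow_zero (d := d) (n + 1) (Nat.lt_succ_self (n + 1))]
      exact tpow_mem_span 0
    · by_cases hin : i + 1 < n + 1
      · rw [← incl_g i hin]
        exact incl_mul_mem_span _ ha
      -- Only the last braiding generator does not come from the smaller algebra.
      obtain rfl : i = n := by omega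
      induction ha using Submodule.span_induction with
      | mem y hy =>
        rcases hy with ⟨a, r, rfl⟩ | ⟨j, hj, hjn, a, b, rfl⟩
        · rw [← (tpow_last_commute_incl r a).eq, ← mul_assoc, g_mul_tpow_succ i hi (by omega),
            ← incl_tpow i (Nat.lt_succ_self i), mul_assoc]
          exact incl_mul_mem_span _ (mul_incl_mem_span _ g_mem_span)
        · obtain rfl : j = i := by omega
          rw [← mul_assoc, ← mul_assoc]
          refine mul_incl_mem_span _ ?_
          -- The factor a is trapped between two copies of the last g. Expanding it one level down
          -- leaves either a framing power, handled by the quadratic relation, or the previous g,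
          -- handled by the braid relation; everything else commutes with the last g.
          have ha := ih a
          clear b
          induction ha using Submodule.span_induction with
          | mem y hy =>
            rcases hy with ⟨a, r, rfl⟩ | ⟨i, hi, hin, a, b, rfl⟩
            · rw [map_mul, incl_tpow, ← mul_assoc, (g_last_commute_incl_incl a).eq,
                mul_assoc _ (g d u j _), g_mul_tpow, mul_assoc, mul_assoc]
              exact incl_mul_mem_span _ (tpow_mul_g_mul_g_mem_span r)
            · subst hin
              rw [map_mul, map_mul, mul_assoc, mul_assoc, mul_assoc,
                ← (g_last_commute_incl_incl b).eq, ← mul_assoc, (g_last_commute_incl_incl a).eq,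
                mul_assoc]
              refine incl_mul_mem_span _ ?_
              rw [← mul_assoc, ← mul_assoc, incl_g, g_braid i (by omega)]
              refine mul_incl_mem_span _ ?_
              rw [← incl_g i (by omega)]
              exact mul_incl_mem_span _ (incl_mul_mem_span _ g_mem_span)
          | zero =>
            rw [map_zero, mul_zero, zero_mul]
            exact Submodule.zero_mem _
          | add x y _ _ hx hy =>
            rw [map_add, mul_add, add_mul]
            exact Submodule.add_mem _ hx hy
          | smul r x _ hx =>
            rw [map_smul, mul_smul_comm, smul_mul_assoc]
            exact Submodule.smul_mem _ r hx
      | zero => rw [mul_zero]; exact Submodule.zero_mem _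
      | add x y _ _ hx hy => rw [mul_add]; exact Submodule.add_mem _ hx hy
      | smul r x _ hx => rw [mul_smul_comm]; exact Submodule.smul_mem _ r hx
    · by_cases hjn : j < n + 1
      · rw [← incl_t j hjn]
        exact incl_mul_mem_span _ ha
      obtain rfl : j = n + 1 := by omega
      rw [t_eq_tpow]
      exact tpow_mul_mem_span 1 ha

end Spanning

/-- Juyumaya's convolution `(x * y)(k) = ∑_s x_{k+s} y_{-s}` on `ℤ/dℤ`. -/
def conv {d : ℕ} [NeZero d] (x y : ZMod d → ℂ) (k : ZMod d) : ℂ := ∑ s : ZMod d, x (k + s) * y (-s)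

/-! ### Evaluation of the Markov trace on multiples of r_{1,2}. -/

namespace IsMarkovTrace

variable {d : ℕ} {u z : ℂ} {x : ZMod d → ℂ} {tr : ∀ n : ℕ, Y d n u →ₗ[ℂ] ℂ}

theorem tr_mul_comm (h : IsMarkovTrace d u z x tr) {n : ℕ} (a b : Y d n u) :
    tr n (a * b) = tr n (b * a) :=
  h.comm n a b

theorem tr_tpow_one (h : IsMarkovTrace d u z x tr) (s : ZMod d) :
    tr 1 (tpow u 0 (Nat.lt_succ_self 0) s) = x s := by
  simpa only [map_one, one_mul, h.one, mul_one] using h.framing 0 1 s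

variable [NeZero d]

/-- Multiplying by the last e convolves the values f with x, which is how iterated idempotents
become iterated convolutions. -/
theorem tr_incl_mul_e (h : IsMarkovTrace d u z x tr) {n : ℕ} (w : Y d (n + 1) u)
    (f : ZMod d → ℂ) (hf : ∀ s, tr (n + 1) (w * tpow u n (Nat.lt_succ_self n) s) = f s) :
    tr (n + 2) (YokonumaHecke.incl d (n + 1) u w * eShift u n (Nat.lt_succ_self (n + 1)) 0)
      = (1 / (d : ℂ)) * ∑ s, f s * x (-s) := by
  rw [eShift_eq_sum n (Nat.lt_succ_self (n + 1)) (by omega), mul_smul_comm, map_smul, smul_eq_mul,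
    Finset.mul_sum, map_sum]
  congr 1
  refine Finset.sum_congr rfl fun s _ => ?_
  rw [← incl_tpow n (Nat.lt_succ_self n), ← mul_assoc, ← map_mul, h.framing, zero_add, hf, mul_comm]

/-- Moving the last framing across g and using cyclicity cancels the two framing powers of each
summand, so all d summands contribute equally. -/
theorem tr_incl_mul_e_mul_g (h : IsMarkovTrace d u z x tr) {n : ℕ} (w : Y d (n + 1) u) :
    tr (n + 2) (YokonumaHecke.incl d (n + 1) u w * (eShift u n (Nat.lt_succ_self (n + 1)) 0
      * g d u n (Nat.lt_succ_self (n + 1)))) = z * tr (n + 1) w := by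
  have hs (s : ZMod d) : tr (n + 2) (YokonumaHecke.incl d (n + 1) u w *
      (tpow u n (by omega) (0 + s) * tpow u (n + 1) (Nat.lt_succ_self (n + 1)) (-s)
      * g d u n (Nat.lt_succ_self (n + 1)))) = z * tr (n + 1) w := by
    rw [mul_assoc, ← g_mul_tpow n _ (by omega), ← mul_assoc, ← mul_assoc,
      ← incl_tpow n (Nat.lt_succ_self n), ← incl_tpow n (Nat.lt_succ_self n), h.tr_mul_comm,
      ← mul_assoc, ← map_mul, ← map_mul, h.markov, h.tr_mul_comm, mul_assoc, ← tpow_add, zero_add,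
      add_neg_cancel, tpow_zero, mul_one]
  rw [eShift_eq_sum n (Nat.lt_succ_self (n + 1)) (by omega), smul_mul_assoc, mul_smul_comm,
    map_smul, smul_eq_mul, Finset.sum_mul, Finset.mul_sum, map_sum]
  simp only [hs, Finset.sum_const, Finset.card_univ, ZMod.card, nsmul_eq_mul]
  rw [← mul_assoc, one_div, inv_mul_cancel₀ (NeZero.ne _), one_mul]

theorem tr_tpow_mul_e (h : IsMarkovTrace d u z x tr) (k : ZMod d) :
    tr 2 (tpow u 0 (by omega) k * eShift u 0 (Nat.lt_succ_self 1) 0) = EShift x k := by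
  rw [← incl_tpow 0 (Nat.lt_succ_self 0), h.tr_incl_mul_e (n := 0) _ (fun s => x (k + s))]
  · rfl
  · intro s
    rw [← tpow_add, h.tr_tpow_one]

theorem tr_tpow_mul_e_mul_g (h : IsMarkovTrace d u z x tr) (k : ZMod d) :
    tr 2 (tpow u 0 (by omega) k
      * (eShift u 0 (Nat.lt_succ_self 1) 0 * g d u 0 (Nat.lt_succ_self 1))) = z * x k := by
  rw [← incl_tpow 0 (Nat.lt_succ_self 0), h.tr_incl_mul_e_mul_g (n := 0), h.tr_tpow_one]

theorem tr_tpow_mul_e_mul_e (h : IsMarkovTrace d u z x tr) (k : ZMod d) :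
    tr 3 (tpow u 0 (by omega) k
        * (eShift u 0 (by omega) 0 * eShift u 1 (Nat.lt_succ_self 2) 0))
      = (1 / (d : ℂ)) * conv (EShift x) x k := by
  have h1 : (1 : ℕ) + 1 < 3 := by omega
  rw [← incl_tpow 0 (show 0 < 2 by omega), ← incl_eShift 0 (Nat.lt_succ_self 1), ← mul_assoc,
    ← map_mul, h.tr_incl_mul_e (n := 1) _ (fun s => EShift x (k + s))]
  · rfl
  · intro s
    rw [mul_assoc, ← tpow_comm_e, tpow_succ_mul_e 0 (Nat.lt_succ_self 1) (by omega), ← mul_assoc,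
      ← tpow_add, h.tr_tpow_mul_e]

theorem tr_tpow_mul_e_mul_e_mul_g (h : IsMarkovTrace d u z x tr) (k : ZMod d) :
    tr 3 (tpow u 0 (by omega) k
        * (eShift u 0 (by omega) 0 * eShift u 1 (Nat.lt_succ_self 2) 0) * g d u 0 (by omega))
      = z * EShift x k := by
  rw [h.tr_mul_comm, ← incl_tpow 0 (show 0 < 2 by omega), ← incl_eShift 0 (Nat.lt_succ_self 1),
    ← incl_g 0 (Nat.lt_succ_self 1), ← mul_assoc, ← mul_assoc, ← map_mul, ← map_mul,
    h.tr_incl_mul_e (n := 1) _ (fun s => z * x (k + s))]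
  · simp only [mul_assoc, ← Finset.mul_sum]
    rw [EShift]
    ring
  · intro s
    rw [mul_assoc, mul_assoc, ← tpow_comm_e, tpow_succ_mul_e 0 (Nat.lt_succ_self 1) (by omega),
      ← mul_assoc (tpow _ _ _ _), ← tpow_add, h.tr_mul_comm, mul_assoc, h.tr_tpow_mul_e_mul_g]

/-- The six terms of the Steinberg element are evaluated separately. The words g_1 g_2 and g_2 g_1
give z²x_k each, g_1 and g_2 give zE^{(k)} each, and the longest word supplies the dependence on u.
-/
theorem tr_tpow_mul_rElt_three (h : IsMarkovTrace d u z x tr) (k : ZMod d) :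
    tr 3 (tpow u 0 (by omega) k * rElt d u 0 (by omega))
      = (d : ℂ) ^ 2 * ((u + 1) * z ^ 2 * x k + (u + 2) * z * EShift x k
        + (1 / (d : ℂ)) * conv (EShift x) x k) := by
  have h1 : (0 : ℕ) + 1 < 3 := by omega
  have h2 : (1 : ℕ) + 1 < 3 := by omega
  have h0 : (0 : ℕ) < 3 := by omega
  have h0' : (0 : ℕ) < 2 := by omega
  have h1' : (0 : ℕ) + 1 < 2 := by omega
  have hF := g_comm_e_mul_e (d := d) (u := u) 0 (by omega) h1
  have key (w : Y d 2 u) : tr 3 (YokonumaHecke.incl d 2 u w *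
      (eShift u 0 h1 0 * eShift u 1 h2 0) * g d u 1 h2) = z * tr 2 (w * eShift u 0 h1' 0) := by
    rw [← h.tr_incl_mul_e_mul_g (n := 1), map_mul (YokonumaHecke.incl d (1 + 1) u), incl_eShift]
    simp only [mul_assoc]
  have t01 : tr 3 (tpow u 0 h0 k * (eShift u 0 h1 0 * eShift u 1 h2 0)
      * (g d u 0 h1 * g d u 1 h2)) = z * (z * x k) := by
    rw [← mul_assoc, mul_assoc _ _ (g d u 0 h1), ← hF, ← mul_assoc, ← incl_tpow 0 h0',
      ← incl_g 0 h1', ← map_mul, key, mul_assoc, g_comm_e, h.tr_tpow_mul_e_mul_g]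
  have t10 : tr 3 (tpow u 0 h0 k * (eShift u 0 h1 0 * eShift u 1 h2 0)
      * (g d u 1 h2 * g d u 0 h1)) = z * (z * x k) := by
    rw [← mul_assoc, h.tr_mul_comm, ← mul_assoc, ← mul_assoc, ← incl_tpow 0 h0',
      ← incl_g 0 h1', ← map_mul, key, mul_assoc, h.tr_mul_comm, mul_assoc, h.tr_tpow_mul_e_mul_g]
  have t1 : tr 3 (tpow u 0 h0 k * (eShift u 0 h1 0 * eShift u 1 h2 0) * g d u 1 h2)
      = z * EShift x k := by
    rw [← incl_tpow 0 h0', key, h.tr_tpow_mul_e]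
  -- Cyclicity brings the outer factors g_1 together once g_2 is traced out; the quadratic relation
  -- for g_1² then produces u and u - 1.
  have t010 : tr 3 (tpow u 0 h0 k * (eShift u 0 h1 0 * eShift u 1 h2 0)
      * (g d u 0 h1 * g d u 1 h2 * g d u 0 h1))
      = z * (u * EShift x k + (u - 1) * (z * x k)) := by
    rw [← mul_assoc, h.tr_mul_comm, ← mul_assoc (_ * _) (g d u 0 h1),
      mul_assoc _ _ (g d u 0 h1), ← hF, ← mul_assoc, ← mul_assoc, ← mul_assoc, ← incl_tpow 0 h0',
      ← incl_g 0 h1', ← map_mul, ← map_mul, key, mul_assoc, g_comm_e,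
      mul_assoc,
      h.tr_mul_comm, mul_assoc, mul_assoc, e_mul_g_mul_g, mul_add, mul_smul_comm, mul_smul_comm,
      map_add, map_smul, map_smul, h.tr_tpow_mul_e, h.tr_tpow_mul_e_mul_g, smul_eq_mul, smul_eq_mul]
  rw [rElt_eq 0 _ h1, mul_smul_comm, map_smul, smul_eq_mul, ← mul_assoc, steinberg]
  simp only [zero_add, mul_add (tpow u 0 h0 k * (eShift u 0 h1 0 * eShift u 1 h2 0)), mul_one,
    map_add]
  rw [t01, t10, t1, t010, h.tr_tpow_mul_e_mul_e, h.tr_tpow_mul_e_mul_e_mul_g]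
  ring

theorem tr_tpow_mul_rElt (h : IsMarkovTrace d u z x tr) (k : ZMod d) {n : ℕ} (hn : 3 ≤ n) (h₀ : 0 < n)
    (h₂ : 0 + 2 < n) : tr n (tpow u 0 h₀ k * rElt d u 0 h₂)
      = (d : ℂ) ^ 2 * ((u + 1) * z ^ 2 * x k + (u + 2) * z * EShift x k
        + (1 / (d : ℂ)) * conv (EShift x) x k) := by
  induction n, hn using Nat.le_induction with
  | base => exact h.tr_tpow_mul_rElt_three k
  | succ n hn ih =>
    rw [← ih (by omega) (by omega), ← h.incl n, map_mul (YokonumaHecke.incl d n u), incl_tpow,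
      incl_rElt]

theorem tr_eShift_mul_eShift (h : IsMarkovTrace d u z x tr) (k : ZMod d) {n : ℕ} (hn : 3 ≤ n)
    (h₁ : 0 + 1 < n) (h₂ : 1 + 1 < n) : tr n (eShift u 0 h₁ k * eShift u 1 h₂ 0)
      = (1 / (d : ℂ)) * conv (EShift x) x k := by
  induction n, hn using Nat.le_induction with
  | base =>
    rw [← h.tr_tpow_mul_e_mul_e, eShift_eq_mul 0 (by omega) (by omega) k]
    simp only [mul_assoc]
  | succ n hn ih =>
    rw [← ih (by omega) (by omega), ← h.incl n, map_mul (YokonumaHecke.incl d n u), incl_eShift,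
      incl_eShift]

/-- The trace vanishes on the left ideal of `r_{1,2}` iff it vanishes on the `t_1^k r_{1,2}`. -/
theorem tr_mul_rElt_zero (h : IsMarkovTrace d u z x tr) {n : ℕ} (hn : 3 ≤ n)
    (h3 : ∀ k : ZMod d, tr 3 (tpow u 0 (by omega) k * rElt d u 0 (by omega)) = 0)
    (hn' : 0 + 2 < n) (a : Y d n u) : tr n (a * rElt d u 0 hn') = 0 := by
  have h0 : (0 : ℕ) < 3 := by omega
  have h1 : (0 : ℕ) + 1 < 3 := by omega
  have h2 : (0 : ℕ) + 2 < 3 := by omega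
  induction n, hn using Nat.le_induction with
  | base =>
    -- The span of the t_1^k r_{1,2} is stable under all generators, hence is the whole left ideal.
    suffices hV : ∀ a : Y d 3 u, a * rElt d u 0 h2 ∈
        Submodule.span ℂ (Set.range fun k : ZMod d => tpow u 0 h0 k * rElt d u 0 h2) by
      refine Submodule.span_induction (p := fun y _ => tr 3 y = 0) ?_ (map_zero _)
        (fun x y _ _ hx hy => by rw [map_add, hx, hy, add_zero])
        (fun c x _ hx => by rw [map_smul, hx, smul_zero]) (hV a)
      rintro _ ⟨k, rfl⟩
      exact h3 k
    intro a
    have hg : ∀ i hi, ∀ y ∈ Submodule.span ℂ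
        (Set.range fun k : ZMod d => tpow u 0 h0 k * rElt d u 0 h2), g d u i hi * y ∈
        Submodule.span ℂ (Set.range fun k : ZMod d => tpow u 0 h0 k * rElt d u 0 h2) := by
      intro i hi y hy
      induction hy using Submodule.span_induction with
      | mem y hy =>
        obtain ⟨k, rfl⟩ := hy
        have hi' : i = 0 ∨ i = 1 := by omega
        rcases hi' with rfl | rfl
        · rw [← mul_assoc, g_mul_tpow, mul_assoc, g_mul_rElt, mul_smul_comm,
            tpow_succ_mul_rElt 0 h2 h0]
          exact Submodule.smul_mem _ _ (Submodule.subset_span ⟨k, rfl⟩)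
        · rw [← mul_assoc, g_mul_tpow_of_ne 1 0 _ _ (by omega) (by omega), mul_assoc,
            g_succ_mul_rElt 0 h2, mul_smul_comm]
          exact Submodule.smul_mem _ _ (Submodule.subset_span ⟨k, rfl⟩)
      | zero => rw [mul_zero]; exact Submodule.zero_mem _
      | add x y _ _ hx hy => rw [mul_add]; exact Submodule.add_mem _ hx hy
      | smul r x _ hx => rw [mul_smul_comm]; exact Submodule.smul_mem _ r hx
    have ht : ∀ j hj, ∀ y ∈ Submodule.span ℂ
        (Set.range fun k : ZMod d => tpow u 0 h0 k * rElt d u 0 h2), t d u j hj * y ∈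
        Submodule.span ℂ (Set.range fun k : ZMod d => tpow u 0 h0 k * rElt d u 0 h2) := by
      intro j hj y hy
      induction hy using Submodule.span_induction with
      | mem y hy =>
        obtain ⟨k, rfl⟩ := hy
        have hr : tpow u j hj (1 : ZMod d) * rElt d u 0 h2 = tpow u 0 h0 1 * rElt d u 0 h2 := by
          have hj' : j = 0 ∨ j = 1 ∨ j = 2 := by omega
          rcases hj' with rfl | rfl | rfl
          · rfl
          · exact tpow_succ_mul_rElt 0 h2 h0 h1 1
          · exact tpow_succ_succ_mul_rElt 0 h2 h0 1
        refine Submodule.subset_span ⟨k + 1, ?_⟩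
        simp only
        rw [t_eq_tpow, ← mul_assoc, tpow_comm, mul_assoc, hr, ← mul_assoc, tpow_add]
      | zero => rw [mul_zero]; exact Submodule.zero_mem _
      | add x y _ _ hx hy => rw [mul_add]; exact Submodule.add_mem _ hx hy
      | smul r x _ hx => rw [mul_smul_comm]; exact Submodule.smul_mem _ r hx
    refine submodule_eq_top ((Submodule.span ℂ (Set.range fun k : ZMod d =>
      tpow u 0 h0 k * rElt d u 0 h2)).comap (LinearMap.mulRight ℂ (rElt d u 0 h2))) ?_
      (fun i hi a ha => ?_) (fun j hj a ha => ?_) a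
    · exact Submodule.subset_span ⟨0, by simp only [tpow_zero]; rfl⟩
    · have := hg i hi _ ha
      rwa [LinearMap.mulRight_apply, ← mul_assoc] at this
    · have := ht j hj _ ha
      rwa [LinearMap.mulRight_apply, ← mul_assoc] at this
  | succ n hn ih =>
    rw [← incl_rElt 0 (by omega)]
    induction mem_span_spanningSet a using Submodule.span_induction with
    | mem y hy =>
      -- A last framing commutes with r_{1,2} and splits off as x_s; a last g splits off as z after
      -- a cyclic rotation. Both leave a left multiple of r_{1,2} one level down.
      rcases hy with ⟨a, s, rfl⟩ | ⟨i, hi, hin, a, b, rfl⟩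
      · rw [mul_assoc, (tpow_last_commute_incl s _).eq, ← mul_assoc, ← map_mul, h.framing, ih h3 (by omega),
          mul_zero]
      · subst hin
        rw [mul_assoc, ← map_mul, h.tr_mul_comm, ← mul_assoc, ← map_mul, h.markov, h.tr_mul_comm,
          ← mul_assoc, ih h3 (by omega), mul_zero]
    | zero => rw [zero_mul, map_zero]
    | add x y _ _ hx hy => rw [add_mul, map_add, hx, hy, add_zero]
    | smul r x _ hx => rw [smul_mul_assoc, map_smul, hx, smul_zero]

end IsMarkovTrace

/-! ### Functionals on quotients, and traces on two-sided ideals. -/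

theorem exists_factor_iff {R : Type*} [Ring R] [Algebra ℂ R] (I : TwoSidedIdeal R) (τ : R →ₗ[ℂ] ℂ) :
    (∃ f : I.ringCon.Quotient →ₗ[ℂ] ℂ, f ∘ₗ (I.ringCon.mkₐ (α := ℂ)).toLinearMap = τ)
      ↔ ∀ y ∈ I, τ y = 0 := by
  constructor
  · rintro ⟨f, rfl⟩ y hy
    have h : I.ringCon.mkₐ (α := ℂ) y = I.ringCon.mkₐ (α := ℂ) 0 :=
      (RingCon.eq _).2 ((I.mem_iff y).1 hy)
    rw [LinearMap.comp_apply, AlgHom.toLinearMap_apply, h, map_zero, map_zero]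
  · intro h
    have hs : Function.Surjective (I.ringCon.mkₐ (α := ℂ)).toLinearMap :=
      RingCon.mkₐ_surjective (α := ℂ) _
    have hk : LinearMap.ker (I.ringCon.mkₐ (α := ℂ)).toLinearMap ≤ LinearMap.ker τ := by
      intro y hy
      refine h y ((I.mem_iff y).2 ((RingCon.eq _).1 ?_))
      rw [RingCon.coe_zero]
      exact hy
    refine ⟨(Submodule.liftQ _ τ hk).comp
      ((I.ringCon.mkₐ (α := ℂ)).toLinearMap.quotKerEquivOfSurjective hs).symm.toLinearMap, ?_⟩
    ext y
    have : ((I.ringCon.mkₐ (α := ℂ)).toLinearMap.quotKerEquivOfSurjective hs).symm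
        ((I.ringCon.mkₐ (α := ℂ)).toLinearMap y) = Submodule.Quotient.mk y := by
      rw [LinearEquiv.symm_apply_eq]
      rfl
    simp only [LinearMap.comp_apply, LinearEquiv.coe_coe, this]
    exact Submodule.liftQ_apply _ _ _

/-- A trace vanishes on a two-sided ideal iff it vanishes on the left ideal of the generators. -/
theorem forall_mem_span_iff {R : Type*} [Ring R] [Algebra ℂ R] (τ : R →ₗ[ℂ] ℂ)
    (hτ : ∀ a b, τ (a * b) = τ (b * a)) (s : Set R) :
    (∀ y ∈ TwoSidedIdeal.span s, τ y = 0) ↔ ∀ y ∈ s, ∀ a, τ (a * y) = 0 := by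
  constructor
  · intro h y hy a
    exact h _ (TwoSidedIdeal.mul_mem_left _ _ _ (TwoSidedIdeal.subset_span hy))
  · intro h y hy
    -- The left radical of the form τ(ab); the trace property makes it two-sided.
    let J : TwoSidedIdeal R := TwoSidedIdeal.mk' {y | ∀ a, τ (a * y) = 0}
      (fun a => by rw [mul_zero, map_zero])
      (fun {x y} hx hy a => by rw [mul_add, map_add, hx a, hy a, add_zero])
      (fun {x} hx a => by rw [mul_neg, map_neg, hx a, neg_zero])
      (fun {x y} hy a => by rw [← mul_assoc]; exact hy _)
      (fun {x y} hx a => by rw [← mul_assoc, hτ, ← mul_assoc]; exact hx _)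
    have hJ : ∀ y ∈ J, ∀ a, τ (a * y) = 0 := fun y hy =>
      (TwoSidedIdeal.mem_mk' _ _ _ _ _ _ y).1 hy
    have hs : TwoSidedIdeal.span s ≤ J :=
      TwoSidedIdeal.span_le.2 fun y hy => (TwoSidedIdeal.mem_mk' _ _ _ _ _ _ y).2 (h y hy)
    simpa only [one_mul] using hJ y (hs hy) 1

theorem ctlIdeal_le_ftlIdeal (d : ℕ) [NeZero d] (n : ℕ) (u : ℂ) :
    ctlIdeal d n u ≤ ftlIdeal d n u := by
  refine TwoSidedIdeal.span_le.2 ?_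
  rintro _ ⟨i, hi, rfl⟩
  rw [cElt_eq i hi (by omega)]
  exact sum_mem fun k _ => TwoSidedIdeal.mul_mem_left _ _ _ (TwoSidedIdeal.subset_span ⟨i, hi, rfl⟩)

theorem PassesToFTL.passesToCTL {d : ℕ} [NeZero d] {n : ℕ} {u : ℂ} {τ : Y d n u →ₗ[ℂ] ℂ}
    (h : PassesToFTL τ) : PassesToCTL τ := by
  have h' := (exists_factor_iff (ftlIdeal d n u) τ).1 h
  exact (exists_factor_iff (ctlIdeal d n u) τ).2 fun y hy => h' y (ctlIdeal_le_ftlIdeal d n u hy)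

/-! ### The system of equations as a criterion for FTL. -/

section Criterion

variable {d : ℕ} [NeZero d] {u z : ℂ} {x : ZMod d → ℂ} {tr : ∀ n : ℕ, Y d n u →ₗ[ℂ] ℂ}

/-- Since r_{i+1,i+2} = p r_{i,i+1} q, cyclicity moves q to the left and lowers i. -/
theorem IsMarkovTrace.tr_mul_rElt (h : IsMarkovTrace d u z x tr) (hu : u ≠ 0) {n : ℕ} (hn : 0 + 2 < n)
    (h0 : ∀ a : Y d n u, tr n (a * rElt d u 0 hn) = 0) (i : ℕ) (hi : i + 2 < n)
    (a : Y d n u) : tr n (a * rElt d u i hi) = 0 := by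
  induction i generalizing a with
  | zero => exact h0 a
  | succ i ih =>
    obtain ⟨p, q, hpq⟩ := rElt_succ (d := d) hu i hi (by omega)
    rw [hpq, ← mul_assoc, h.tr_mul_comm, ← mul_assoc, ← mul_assoc]
    exact ih _ _

theorem IsMarkovTrace.passesToFTL_iff (h : IsMarkovTrace d u z x tr) (hu : u ≠ 0) {n : ℕ}
    (hn : 3 ≤ n) :
    PassesToFTL (tr n) ↔ ∀ k : ZMod d, (u + 1) * z ^ 2 * x k + (u + 2) * z * EShift x k
      + (1 / (d : ℂ)) * conv (EShift x) x k = 0 := by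
  have hd : (d : ℂ) ^ 2 ≠ 0 := pow_ne_zero _ (NeZero.ne _)
  refine (exists_factor_iff (ftlIdeal d n u) (tr n)).trans
    ((forall_mem_span_iff _ (h.comm n) _).trans ⟨fun H k => ?_, fun H => ?_⟩)
  · have := H _ ⟨0, by omega, rfl⟩ (tpow u 0 (by omega) k)
    rw [h.tr_tpow_mul_rElt k hn (by omega) (by omega)] at this
    exact (mul_eq_zero.1 this).resolve_left hd
  · rintro _ ⟨i, hi, rfl⟩ a
    refine h.tr_mul_rElt hu (by omega) (h.tr_mul_rElt_zero hn (fun k => ?_) _) i hi a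
    rw [h.tr_tpow_mul_rElt_three, H, mul_zero]

end Criterion

/-! ### Solving the equations by the Fourier transform on ℤ/dℤ. -/

section Fourier

variable {d : ℕ} [NeZero d]

theorem dft_conv (x y : ZMod d → ℂ) (m : ZMod d) :
    ZMod.dft (conv x y) m = ZMod.dft x m * ZMod.dft y m := by
  simp only [ZMod.dft_apply, conv, smul_eq_mul]
  rw [Finset.sum_mul_sum]
  simp only [Finset.mul_sum]
  rw [Finset.sum_comm]
  conv_rhs => rw [Finset.sum_comm, ← Equiv.sum_comp (Equiv.neg _)]
  refine Finset.sum_congr rfl fun s _ => ?_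
  rw [← Equiv.sum_comp (Equiv.subRight s)]
  refine Finset.sum_congr rfl fun k _ => ?_
  have : -((k - s) * m) = -(k * m) + -(-s * m) := by ring
  simp only [Equiv.subRight_apply, Equiv.neg_apply, sub_add_cancel, this, AddChar.map_add_eq_mul]
  ring

theorem EShift_eq (x : ZMod d → ℂ) : EShift x = (1 / (d : ℂ)) • conv x x := rfl

theorem equations_iff_dft (u z : ℂ) (x : ZMod d → ℂ) :
    (∀ k : ZMod d, (u + 1) * z ^ 2 * x k + (u + 2) * z * EShift x k
      + (1 / (d : ℂ)) * conv (EShift x) x k = 0) ↔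
    ∀ m : ZMod d, ZMod.dft x m = 0 ∨ ZMod.dft x m = -(d * z) ∨
      ZMod.dft x m = -(d * z) * (u + 1) := by
  have hd : (d : ℂ) ≠ 0 := NeZero.ne _
  let F : ZMod d → ℂ := ((u + 1) * z ^ 2) • x + ((u + 2) * z) • EShift x
    + (1 / (d : ℂ)) • conv (EShift x) x
  have hF : ∀ m, ZMod.dft F m = 1 / (d : ℂ) ^ 2 * (ZMod.dft x m * ((ZMod.dft x m - -(d * z))
      * (ZMod.dft x m - -(d * z) * (u + 1)))) := fun m => by
    simp only [F, map_add, map_smul, Pi.add_apply, Pi.smul_apply, smul_eq_mul, dft_conv, EShift_eq]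
    field_simp
    ring
  have h1 : (∀ k : ZMod d, (u + 1) * z ^ 2 * x k + (u + 2) * z * EShift x k
      + (1 / (d : ℂ)) * conv (EShift x) x k = 0) ↔ F = 0 := funext_iff.symm
  rw [h1, ← (ZMod.dft (N := d) (E := ℂ)).map_eq_zero_iff, funext_iff]
  refine forall_congr' fun m => ?_
  rw [hF, Pi.zero_apply]
  rw [mul_eq_zero, or_iff_right (one_div_ne_zero (pow_ne_zero 2 hd)), mul_eq_zero, mul_eq_zero,
    sub_eq_zero, sub_eq_zero]

/-- The 1/d of Fourier inversion cancels the d in the values -dz and -dz(u+1). -/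
theorem sum_char_eq_symm_dft (u z : ℂ) (S₁ S₂ : Finset (ZMod d)) (k : ZMod d) :
    -z * (∑ m ∈ S₁, ZMod.stdAddChar (k * m) + (u + 1) * ∑ m ∈ S₂, ZMod.stdAddChar (k * m))
      = ZMod.dft.symm (fun m => -(d * z) * ((if m ∈ S₁ then 1 else 0)
          + (u + 1) * (if m ∈ S₂ then 1 else 0)) : ZMod d → ℂ) k := by
  have hd : (d : ℂ) ≠ 0 := NeZero.ne _
  rw [ZMod.invDFT_apply]
  have : ∀ S : Finset (ZMod d), ∑ m ∈ S, (ZMod.stdAddChar (k * m) : ℂ)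
      = ∑ m, ZMod.stdAddChar (m * k) * (if m ∈ S then 1 else 0) := fun S => by
    simp [mul_comm]
  rw [this, this, smul_eq_mul, Finset.mul_sum, ← Finset.sum_add_distrib, Finset.mul_sum,
    Finset.mul_sum]
  refine Finset.sum_congr rfl fun m _ => ?_
  rw [smul_eq_mul]
  field_simp

theorem sum_char_eq_iff (u z : ℂ) (x : ZMod d → ℂ) (S₁ S₂ : Finset (ZMod d)) :
    (∀ k : ZMod d, x k = -z * (∑ m ∈ S₁, ZMod.stdAddChar (k * m)
      + (u + 1) * ∑ m ∈ S₂, ZMod.stdAddChar (k * m))) ↔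
    ∀ m, ZMod.dft x m = -(d * z) * ((if m ∈ S₁ then 1 else 0)
      + (u + 1) * (if m ∈ S₂ then 1 else 0)) := by
  simp only [sum_char_eq_symm_dft]
  rw [← funext_iff, LinearEquiv.eq_symm_apply, funext_iff]

theorem dft_iff_supportCondition {u : ℂ} (hu : u ≠ 0) (z : ℂ) (x : ZMod d → ℂ) (hx : x 0 = 1) :
    (∀ m : ZMod d, ZMod.dft x m = 0 ∨ ZMod.dft x m = -(d * z) ∨
      ZMod.dft x m = -(d * z) * (u + 1)) ↔ SupportCondition u z x := by
  classical
  have hd : (d : ℂ) ≠ 0 := NeZero.ne _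
  constructor
  · intro h
    -- If z = 0 the transform vanishes identically, against x_0 = 1.
    have hz : z ≠ 0 := by
      rintro rfl
      have : ZMod.dft x = 0 := funext fun m => by simpa using h m
      rw [LinearEquiv.map_eq_zero_iff] at this
      simp [this] at hx
    have hdz : (d : ℂ) * z ≠ 0 := mul_ne_zero hd hz
    -- The nonvanishing clause in S₂ matters when u = -1: the second root is then 0, and S₂ must
    -- stay inside the support.
    let S₁ := Finset.univ.filter fun m => ZMod.dft x m = -(d * z)
    let S₂ := Finset.univ.filter fun m => ZMod.dft x m ≠ 0 ∧ ZMod.dft x m = -(d * z) * (u + 1)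
    have hne : -(d * z) * (u + 1) ≠ -(d * z) := fun h => by
      have h' : (d * z) * u = 0 := by linear_combination -h
      exact (mul_ne_zero hdz hu) h'
    have hdisj : Disjoint S₁ S₂ := by
      rw [Finset.disjoint_left]
      intro m h1 h2
      simp only [S₁, S₂, Finset.mem_filter, Finset.mem_univ, true_and] at h1 h2
      exact hne (h2.2.symm.trans h1)
    have hformula : ∀ k : ZMod d, x k = -z * (∑ m ∈ S₁, ZMod.stdAddChar (k * m)
        + (u + 1) * ∑ m ∈ S₂, ZMod.stdAddChar (k * m)) := by
      rw [sum_char_eq_iff]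
      intro m
      simp only [S₁, S₂, Finset.mem_filter, Finset.mem_univ, true_and]
      rcases eq_or_ne (ZMod.dft x m) 0 with h0 | h0
      · simp [h0, hd, hz]
      · rcases (h m).resolve_left h0 with h1 | h1
        · rw [if_pos h1, if_neg fun h2 => hne (h2.2.symm.trans h1), h1]; ring
        · rw [if_neg (by rw [h1]; exact hne), if_pos ⟨h0, h1⟩, h1]; ring
    -- At k = 0 all characters are 1, so 1 = -z(|S₁| + (u+1)|S₂|); this yields both the nonzero
    -- denominator and z.
    have hone := hformula 0
    simp only [zero_mul, AddChar.map_zero_eq_one, Finset.sum_const, nsmul_eq_mul, mul_one, hx]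
      at hone
    have hc : (S₁.card : ℂ) + (u + 1) * S₂.card ≠ 0 := fun h => by
      rw [h, mul_zero] at hone
      exact one_ne_zero hone
    refine ⟨S₁, S₂, hdisj, ?_, hformula, hc, ?_⟩
    · ext m
      simp only [S₁, S₂, Finset.coe_filter, Finset.mem_univ, true_and, Set.mem_union,
        Set.mem_ofPred_eq, Function.mem_support]
      constructor
      · rintro (h1 | h1)
        · rw [h1]; exact neg_ne_zero.2 hdz
        · exact h1.1
      · intro h0
        exact ((h m).resolve_left h0).imp id fun h1 => ⟨h0, h1⟩
    · rw [eq_div_iff hc]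
      linear_combination hone
  -- Disjointness rules out the value -dz(u+2), leaving only the three roots.
  · rintro ⟨S₁, S₂, hdisj, -, hformula, -⟩ m
    rw [sum_char_eq_iff] at hformula
    rw [hformula m]
    by_cases h1 : m ∈ S₁
    · have h2 : m ∉ S₂ := Finset.disjoint_left.1 hdisj h1
      simp [h1, h2]
    · by_cases h2 : m ∈ S₂ <;> simp [h1, h2]

end Fourier

end YokonumaHecke

theorem mainTheorem4 (d : ℕ) [NeZero d] (u : ℂ) (hu : u ≠ 0) (z : ℂ) (x : ZMod d → ℂ)
    (hx : x 0 = 1) (tr : ∀ n : ℕ, YokonumaHecke.Y d n u →ₗ[ℂ] ℂ)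
    (htr : YokonumaHecke.IsMarkovTrace d u z x tr) (n : ℕ) (hn : 3 ≤ n) :
    -- the trace passes to `FTL` iff the system of equations holds
    (YokonumaHecke.PassesToFTL (tr n) ↔
      ∀ k : ZMod d,
        (u + 1) * z ^ 2 * x k + (u + 2) * z * YokonumaHecke.EShift x k
          + tr n (YokonumaHecke.eShift u 0 (by omega) k
              * YokonumaHecke.eShift u 1 (by omega) (0 : ZMod d)) = 0) ∧
    -- this is a restatement of the description by the support of the Fourier transform
    (YokonumaHecke.PassesToFTL (tr n) ↔ YokonumaHecke.SupportCondition u z x) ∧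
    -- hence the trace conditions for `FTL` are contained in those for `CTL`
    (YokonumaHecke.PassesToFTL (tr n) →
      YokonumaHecke.PassesToCTL (tr n) ∧
        (u + 1) * z ^ 2 * ∑ k : ZMod d, x k
          + (u + 2) * z * ∑ k : ZMod d, YokonumaHecke.EShift x k
          + ∑ k : ZMod d, tr n (YokonumaHecke.eShift u 0 (by omega) k
              * YokonumaHecke.eShift u 1 (by omega) (0 : ZMod d)) = 0) := by
  have hiff := htr.passesToFTL_iff hu hn
  simp only [htr.tr_eShift_mul_eShift _ hn]
  refine ⟨hiff, hiff.trans ((YokonumaHecke.equations_iff_dft u z x).trans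
    (YokonumaHecke.dft_iff_supportCondition hu z x hx)), fun h => ⟨h.passesToCTL, ?_⟩⟩
  rw [Finset.mul_sum, Finset.mul_sum, ← Finset.sum_add_distrib, ← Finset.sum_add_distrib]
  exact Finset.sum_eq_zero fun k _ => hiff.1 h k
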